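/- Let $\{\varphi_n\}_{n\in I}$ ($I=\mathbb N$ or $I=\mathbb Z$ or, more generally, any non-empty index set) be an orthonormal system of complex-valued functions in $L_2[0,1]$ with $\sup_{n}\|\varphi_n\|_{L_\infty}=M<\infty$. For $f\in L_1[0,1]$ put $c_n(f)=\int_0^1 f(x)\overline{\varphi_n(x)}\,dx$ and $\mathcal F(f)=\{c_n(f)\}_{n\in I}$. Denote by $f^*$ the non-increasing rearrangement of $|f|$ on $[0,1]$, i.e. $f^*(u)=\inf\{s\ge 0: |\{x\in[0,1]:|f(x)|>s\}|\le u\}$, and by $c_1^*\ge c_2^*\ge\dots$ the non-increasing rearrangement of a family $\{|c_n|\}_{n\in I}$, i.e. $c_k^*=\inf\{s\ge 0:\#\{n\in I:|c_n|>s\}\le k-1\}$. For $0<q\le\infty$ and $\alpha\in\mathbb R$ let $$\|f\|_{L^{\mathcal R}_{2,q,\alpha,2}}=\left(\int_0^1\left[(1+|\log t|)^\alpha\left(\int_t^1 f^*(u)^2\,du\right)^{1/2}\right]^q\frac{dt}{t}\right)^{1/q},$$ $$\|c\|_{l^{\mathcal L}_{2,q,\alpha,2}}=\left(\sum_{k=1}^\infty\left[(1+\log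 k)^\alpha\left(\sum_{i=1}^k (c_i^*)^2\right)^{1/2}\right]^q\frac1k\right)^{1/q},$$ with the integral over $t$ and the sum over $k$ replaced by suprema when $q=\infty$, and let $L^{\mathcal R}_{2,q,\alpha,2}$ be the set of all measurable $f:[0,1]\to\mathbb C$ with $\|f\|_{L^{\mathcal R}_{2,q,\alpha,2}}<\infty$. **Theorem.** Let $0<q\le\infty$ and $\alpha<-1/q$ (with $1/\infty=0$). There is a constant $C>0$, depending only on $q$ and $\alpha$, such that for every such system $\{\varphi_n\}$, with its $M$, every $f\in L^{\mathcal R}_{2,q,\alpha,2}$ is integrable (so that $\mathcal F(f)$ is defined) and $$\|\mathcal F(f)\|_{l^{\mathcal L}_{2,q,\alpha,2}}\le C\,\min\bigl(M,(1+\log M)^{|\alpha|}\bigr)\,\|f\|_{L^{\mathcal R}_{2,q,\alpha,2}}.$$ -/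

import Mathlib

open MeasureTheory
open scoped ENNReal NNReal ComplexConjugate

noncomputable section

namespace LimitingFourier

/-- Lebesgue measure on `[0, 1]`. -/
abbrev μ01 : Measure ℝ := volume.restrict (Set.Icc (0 : ℝ) 1)

/-- The non-increasing rearrangement `f*` of `|f|` on `[0, 1]`:
`f*(u) = inf {s ≥ 0 : |{x ∈ [0, 1] : |f x| > s}| ≤ u}`. -/
def rearr (f : ℝ → ℂ) (u : ℝ) : ℝ≥0∞ :=
  sInf {s : ℝ≥0∞ | μ01 {x | s < ‖f x‖ₑ} ≤ ENNReal.ofReal u}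

/-- The non-increasing rearrangement of a family `|c|`, numbered from `0`:
`seqRearr c k` is `c*_{k+1} = inf {s ≥ 0 : #{n : |c n| > s} ≤ k}`. -/
def seqRearr {ι : Type} (c : ι → ℂ) (k : ℕ) : ℝ≥0∞ :=
  sInf {s : ℝ≥0∞ | Set.encard {n | s < ‖c n‖ₑ} ≤ (k : ℕ∞)}

/-- The quasi-norm of `L^R_{2,q,α,2}`: the `L_q(0,1)`-quasi-norm of
`t^{-1/q} (1 + |log t|)^α (∫_t^1 f*(u)² du)^{1/2}`. -/
def normLR (q : ℝ≥0∞) (α : ℝ) (f : ℝ → ℂ) : ℝ≥0∞ :=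
  eLpNorm
    (fun t : ℝ =>
      ENNReal.ofReal (t ^ (-(q⁻¹).toReal) * (1 + |Real.log t|) ^ α) *
        (∫⁻ u in Set.Ioo t 1, rearr f u ^ 2) ^ (1 / 2 : ℝ))
    q (volume.restrict (Set.Ioo (0 : ℝ) 1))

/-- The quasi-norm of `l^L_{2,q,α,2}`: the `l_q`-quasi-norm over `k = 1, 2, …` of
`k^{-1/q} (1 + log k)^α (∑_{i ≤ k} (c*_i)²)^{1/2}`; here `k` is shifted by one. -/
def normlL {ι : Type} (q : ℝ≥0∞) (α : ℝ) (c : ι → ℂ) : ℝ≥0∞ :=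
  eLpNorm
    (fun k : ℕ =>
      ENNReal.ofReal
          (((k : ℝ) + 1) ^ (-(q⁻¹).toReal) * (1 + Real.log ((k : ℝ) + 1)) ^ α) *
        (∑ i ∈ Finset.range (k + 1), seqRearr c i ^ 2) ^ (1 / 2 : ℝ))
    q Measure.count

/-- Membership in `L^R_{2,q,α,2}`. -/
def MemLR (q : ℝ≥0∞) (α : ℝ) (f : ℝ → ℂ) : Prop :=
  AEStronglyMeasurable f μ01 ∧ normLR q α f < ∞

/-- The Fourier coefficients `c_n(f) = ∫_0^1 f(x) conj(φ_n(x)) dx`. -/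
def fourierCoeffs {ι : Type} (φ : ι → Lp ℂ 2 μ01) (f : ℝ → ℂ) (n : ι) : ℂ :=
  ∫ x, f x * conj (φ n x) ∂μ01

end LimitingFourier

end

/-!
Split `f` at the height `f*(s)` with `s = 1 / (M² k)`. The part below it lies in `L_2`, and Bessel's
inequality bounds the sum of the squares of its coefficients by `s f*(s)² + ∫_s^1 (f*)²`. The part
above it has `L_1` norm at most `∫_0^s f*`, so each of its coefficients is at most `M ∫_0^s f*`, and
`k` of them contribute `M² k (∫_0^s f*)² = s⁻¹ (∫_0^s f*)²`. Cutting `(0, s)` at the points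
`s / 16^j`, the Cauchy–Schwarz inequality bounds `s^{-1/2} ∫_0^s f*` by
`sup_j 2^{-j} (∫_{s / 16^j}^1 (f*)²)^{1/2}`.

It remains to take weighted `l_q` norms in `k`. For `a = 1 / (M² 16^j)` the weight at `k` is
comparable with the weight on `(a / (k + 1), a / k)`, up to the factor `(1 + log (2 / a))^{-α}`.
This factor is polynomial in `j`, so it is absorbed by `2^{-j}`, and what is left of it is
`(1 + log M)^{-α}`, which is `O(M)` as well.
-/

namespace LimitingFourier

section LpNorm

variable {X : Type*} [MeasurableSpace X] {μ : Measure X} {q : ℝ≥0∞}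

theorem rpow_mul_measure_le_setLIntegral {I : Set X} (hI : MeasurableSet I) {p : ℝ} (hp : 0 < p)
    {u : ℝ≥0∞} {D : ℝ≥0} (hfin : μ I ≠ ∞) {g : X → ℝ≥0∞}
    (h : ∀ x ∈ I, u ≤ D * μ I ^ p⁻¹ * g x) :
    u ^ p * μ I ≤ D ^ p * (∫⁻ x in I, g x ^ p ∂μ) * μ I := by
  have hpow : ∀ x ∈ I, u ^ p ≤ D ^ p * μ I * g x ^ p := fun x hx => by
    refine (ENNReal.rpow_le_rpow (h x hx) hp.le).trans_eq ?_
    rw [ENNReal.mul_rpow_of_nonneg _ _ hp.le, ENNReal.mul_rpow_of_nonneg _ _ hp.le,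
      ENNReal.rpow_inv_rpow hp.ne']
  have hD : (D : ℝ≥0∞) ^ p * μ I ≠ ∞ :=
    ENNReal.mul_ne_top (ENNReal.rpow_ne_top_of_nonneg hp.le ENNReal.coe_ne_top) hfin
  calc u ^ p * μ I = ∫⁻ _ in I, u ^ p ∂μ := (setLIntegral_const _ _).symm
    _ ≤ ∫⁻ x in I, D ^ p * μ I * g x ^ p ∂μ := setLIntegral_mono' hI hpow
    _ = D ^ p * (∫⁻ x in I, g x ^ p ∂μ) * μ I := by
      rw [lintegral_const_mul' _ _ hD, mul_right_comm]

theorem eLpNorm_count_le_of_le_on_disjoint {ι : Type*} [Countable ι] [MeasurableSpace ι]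
    [MeasurableSingletonClass ι] {I : ι → Set X} (hI : ∀ k, MeasurableSet (I k))
    (hdisj : Pairwise (Function.onFun Disjoint I)) (hpos : ∀ k, μ (I k) ≠ 0)
    (hfin : ∀ k, μ (I k) ≠ ∞) {u : ι → ℝ≥0∞} {g : X → ℝ≥0∞} {D : ℝ≥0}
    (h : ∀ k, ∀ x ∈ I k, u k ≤ D * μ (I k) ^ (q⁻¹).toReal * g x) :
    eLpNorm u q Measure.count ≤ D * eLpNorm g q μ := by
  rcases eq_or_ne q 0 with rfl | hq
  · simp
  rcases eq_or_ne q ∞ with rfl | hqt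
  · simp only [eLpNorm_exponent_top]
    refine eLpNormEssSup_le_of_ae_enorm_bound (.of_forall fun k => ?_)
    have : (ae (μ.restrict (I k))).NeBot := by
      rw [ae_neBot, Ne, Measure.restrict_eq_zero]
      exact hpos k
    obtain ⟨x, hx, hxI⟩ := ((ae_restrict_of_ae (s := I k) (enorm_ae_le_eLpNormEssSup g μ)).and
      (ae_restrict_mem (hI k))).exists
    calc u k ≤ D * g x := by simpa using h k x hxI
      _ ≤ D * eLpNormEssSup g μ := by gcongr; exact hx
  · set p := q.toReal
    have hp : 0 < p := ENNReal.toReal_pos hq hqt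
    rw [ENNReal.toReal_inv] at h
    have hterm (k) : u k ^ p ≤ D ^ p * ∫⁻ x in I k, g x ^ p ∂μ :=
      (ENNReal.mul_le_mul_iff_left (hpos k) (hfin k)).1
        (rpow_mul_measure_le_setLIntegral (hI k) hp (hfin k) (h k))
    simp only [eLpNorm_eq_lintegral_rpow_enorm_toReal hq hqt, enorm_eq_self, lintegral_count]
    calc (∑' k, u k ^ p) ^ (1 / p) ≤ (D ^ p * ∫⁻ x, g x ^ p ∂μ) ^ (1 / p) := by
          gcongr
          calc ∑' k, u k ^ p ≤ ∑' k, D ^ p * ∫⁻ x in I k, g x ^ p ∂μ := ENNReal.tsum_le_tsum hterm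
            _ = D ^ p * ∫⁻ x in ⋃ k, I k, g x ^ p ∂μ := by
              rw [ENNReal.tsum_mul_left, lintegral_iUnion hI hdisj]
            _ ≤ D ^ p * ∫⁻ x, g x ^ p ∂μ := by gcongr; exact Measure.restrict_le_self
      _ = D * (∫⁻ x, g x ^ p ∂μ) ^ (1 / p) := by
          rw [ENNReal.mul_rpow_of_nonneg _ _ (by positivity), one_div, ENNReal.rpow_rpow_inv hp.ne']

theorem lintegral_iSup_rpow_le {ι : Type*} [Countable ι] {p : ℝ} (hp : 0 < p)
    {g : ι → X → ℝ≥0∞} (hg : ∀ j, AEMeasurable (g j) μ) :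
    ∫⁻ x, (⨆ j, g j x) ^ p ∂μ ≤ ∑' j, ∫⁻ x, g j x ^ p ∂μ := by
  rw [← lintegral_tsum fun j => (hg j).pow_const p]
  refine lintegral_mono fun x => ?_
  rw [← ENNReal.le_rpow_inv_iff hp]
  exact iSup_le fun j => (ENNReal.le_rpow_inv_iff hp).2 (ENNReal.le_tsum j)

/- For `q < 1` the quasi-norm has no triangle inequality for the sum over `j`; the supremum only
needs `(⨆ j, g j) ^ q ≤ ∑' j, g j ^ q`, which is available for every `q`. -/
theorem exists_eLpNorm_iSup_le_of_geometric (q : ℝ≥0∞) {r : ℝ≥0∞} (hr : r < 1) :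
    ∃ C : ℝ≥0, ∀ (g : ℕ → X → ℝ≥0∞) (B : ℝ≥0∞), (∀ j, AEMeasurable (g j) μ) →
      (∀ j, eLpNorm (g j) q μ ≤ r ^ j * B) → eLpNorm (fun x => ⨆ j, g j x) q μ ≤ C * B := by
  rcases eq_or_ne q 0 with rfl | hq
  · exact ⟨0, by simp⟩
  rcases eq_or_ne q ∞ with rfl | hqt
  · refine ⟨1, fun g B _ h => ?_⟩
    simp only [eLpNorm_exponent_top] at h ⊢
    refine eLpNormEssSup_le_of_ae_enorm_bound ?_
    filter_upwards [ae_all_iff.2 fun j => enorm_ae_le_eLpNormEssSup (g j) μ] with x hx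
    refine iSup_le fun j => (hx j).trans ((h j).trans ?_)
    gcongr
    exact pow_le_one₀ zero_le hr.le
  · set p := q.toReal
    have hp : 0 < p := ENNReal.toReal_pos hq hqt
    have hrp : r ^ p < 1 := ENNReal.rpow_lt_one hr hp
    have hfin : (1 - r ^ p)⁻¹ ^ (1 / p) ≠ ∞ :=
      ENNReal.rpow_ne_top_of_nonneg (by positivity) (ENNReal.inv_ne_top.2 (tsub_pos_of_lt hrp).ne')
    refine ⟨((1 - r ^ p)⁻¹ ^ (1 / p)).toNNReal, fun g B hg h => ?_⟩
    simp only [eLpNorm_eq_lintegral_rpow_enorm_toReal hq hqt, enorm_eq_self] at h ⊢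
    have hterm (j) : ∫⁻ x, g j x ^ p ∂μ ≤ (r ^ p) ^ j * B ^ p := by
      have hj := (ENNReal.rpow_inv_le_iff hp).1 ((one_div p).symm ▸ h j)
      rwa [ENNReal.mul_rpow_of_nonneg _ _ hp.le, ← ENNReal.rpow_natCast_mul,
        mul_comm (j : ℝ), ENNReal.rpow_mul_natCast] at hj
    calc (∫⁻ x, (⨆ j, g j x) ^ p ∂μ) ^ (1 / p) ≤ (∑' j, (r ^ p) ^ j * B ^ p) ^ (1 / p) := by
          gcongr
          exact (lintegral_iSup_rpow_le hp hg).trans (ENNReal.tsum_le_tsum hterm)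
      _ = ((1 - r ^ p)⁻¹ ^ (1 / p)).toNNReal * B := by
          rw [ENNReal.tsum_mul_right, ENNReal.tsum_geometric, ENNReal.coe_toNNReal hfin,
            ENNReal.mul_rpow_of_nonneg _ _ (by positivity), one_div, ENNReal.rpow_rpow_inv hp.ne']

end LpNorm

section Tail

/-- The `L_2` norm of `g` over `(t, 1)`; for `g = f*` it is the inner functional of `normLR`. -/
noncomputable def tail (g : ℝ → ℝ≥0∞) (t : ℝ) : ℝ≥0∞ :=
  (∫⁻ u in Set.Ioo t 1, g u ^ 2) ^ (1 / 2 : ℝ)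

/-- The `L_1` norm of `g` over `(0, s)`. -/
noncomputable def head (g : ℝ → ℝ≥0∞) (s : ℝ) : ℝ≥0∞ :=
  ∫⁻ u in Set.Ioo 0 s, g u

/-- The maximal function of `tail g` along the scales `s, s / 16, s / 16², …`, damped by `2⁻ʲ`.
With base `16` the square root of the `j`-th scale is `4⁻ʲ √s`, which splits into a factor `2⁻ʲ`
summable in `j` and the damping `2⁻ʲ`. -/
noncomputable def tailSup (g : ℝ → ℝ≥0∞) (s : ℝ) : ℝ≥0∞ :=
  ⨆ j : ℕ, 2⁻¹ ^ j * tail g (s / 16 ^ j)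

theorem rpow_half_sq (x : ℝ≥0∞) : (x ^ (1 / 2 : ℝ)) ^ 2 = x := by
  rw [← ENNReal.rpow_two, one_div, ENNReal.rpow_inv_rpow two_ne_zero]

theorem rpow_half_le_of_le_sq {x y : ℝ≥0∞} (h : x ≤ y ^ 2) : x ^ (1 / 2 : ℝ) ≤ y := by
  rwa [one_div, ENNReal.rpow_inv_le_iff two_pos, ENNReal.rpow_two]

variable (g : ℝ → ℝ≥0∞)

theorem tail_antitone : Antitone (tail g) := fun _ _ h =>
  ENNReal.rpow_le_rpow (lintegral_mono_set (Set.Ioo_subset_Ioo_left h)) (by norm_num)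

theorem tail_sq (t : ℝ) : tail g t ^ 2 = ∫⁻ u in Set.Ioo t 1, g u ^ 2 :=
  rpow_half_sq _

theorem tail_le_tailSup (s : ℝ) : tail g s ≤ tailSup g s :=
  le_iSup_of_le 0 (by simp)

variable {g}

theorem setLIntegral_Ioc_le_tail_mul (hg : Measurable g) {b c : ℝ} (hb : b ≤ 1) :
    ∫⁻ u in Set.Ioc c b, g u ≤ tail g c * ENNReal.ofReal (b - c) ^ (1 / 2 : ℝ) := by
  have hCS := ENNReal.lintegral_mul_le_Lp_mul_Lq (volume.restrict (Set.Ioo c b))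
    Real.HolderConjugate.two_two hg.aemeasurable (aemeasurable_const (b := (1 : ℝ≥0∞)))
  simp only [Pi.mul_apply, mul_one, lintegral_const, Measure.restrict_apply_univ,
    Real.volume_Ioo, ENNReal.rpow_two, one_pow, one_mul] at hCS
  rw [setLIntegral_congr Ioo_ae_eq_Ioc.symm]
  refine hCS.trans ?_
  gcongr
  exact ENNReal.rpow_le_rpow (lintegral_mono_set (Set.Ioo_subset_Ioo_right hb)) (by norm_num)

theorem Ioo_subset_iUnion_Ioc_div_pow {b : ℝ} (hb : 1 < b) (s : ℝ) :
    Set.Ioo 0 s ⊆ ⋃ j : ℕ, Set.Ioc (s / b ^ (j + 1)) (s / b ^ j) := by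
  rintro u ⟨hu, hus⟩
  have hs : 0 < s := hu.trans hus
  obtain ⟨j, hj, hj'⟩ := exists_nat_pow_near_of_lt_one (div_pos hu hs)
    ((div_le_one hs).2 hus.le) (inv_pos.2 (one_pos.trans hb)) (inv_lt_one_of_one_lt₀ hb)
  rw [lt_div_iff₀ hs, inv_pow, ← div_eq_inv_mul] at hj
  rw [div_le_iff₀ hs, inv_pow, ← div_eq_inv_mul] at hj'
  exact Set.mem_iUnion.2 ⟨j, hj, hj'⟩

theorem ofReal_div_sixteen_pow_rpow_half (s : ℝ) (j : ℕ) :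
    ENNReal.ofReal (s / 16 ^ j) ^ (1 / 2 : ℝ) =
      ENNReal.ofReal s ^ (1 / 2 : ℝ) * (2⁻¹ ^ j * 2⁻¹ ^ j) := by
  have hsq : ENNReal.ofReal (s / 16 ^ j) = ENNReal.ofReal s * (2⁻¹ ^ j * 2⁻¹ ^ j) ^ 2 := by
    have h16 : (16 : ℝ≥0∞)⁻¹ = 2⁻¹ ^ 4 := by rw [← ENNReal.inv_pow]; norm_num
    rw [ENNReal.ofReal_div_of_pos (by positivity), ENNReal.ofReal_pow (by norm_num),
      div_eq_mul_inv, ENNReal.ofReal_ofNat, ENNReal.inv_pow, h16]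
    ring
  rw [hsq, ENNReal.mul_rpow_of_nonneg _ _ (by norm_num), ← ENNReal.rpow_two, one_div,
    ENNReal.rpow_rpow_inv two_ne_zero]

theorem setLIntegral_Ioc_div_sixteen_pow_le (hg : Measurable g) {s : ℝ} (hs : 0 < s) (hs1 : s ≤ 1)
    (j : ℕ) : ∫⁻ u in Set.Ioc (s / 16 ^ (j + 1)) (s / 16 ^ j), g u ≤
      2⁻¹ ^ j * (2 * (ENNReal.ofReal s ^ (1 / 2 : ℝ) * tailSup g s)) := by
  have hb : s / 16 ^ j ≤ 1 := div_le_one_of_le₀ (hs1.trans (one_le_pow₀ (by norm_num)))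
    (by positivity)
  have hsup : 2⁻¹ ^ (j + 1) * tail g (s / 16 ^ (j + 1)) ≤ tailSup g s :=
    le_iSup (fun j : ℕ => 2⁻¹ ^ j * tail g (s / 16 ^ j)) (j + 1)
  calc ∫⁻ u in Set.Ioc (s / 16 ^ (j + 1)) (s / 16 ^ j), g u
      ≤ tail g (s / 16 ^ (j + 1)) * ENNReal.ofReal (s / 16 ^ j) ^ (1 / 2 : ℝ) := by
        refine (setLIntegral_Ioc_le_tail_mul hg hb).trans ?_
        gcongr
        exact sub_le_self _ (by positivity)
    _ = 2⁻¹ ^ j * (2 * (ENNReal.ofReal s ^ (1 / 2 : ℝ) *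
          (2⁻¹ ^ (j + 1) * tail g (s / 16 ^ (j + 1))))) := by
        rw [ofReal_div_sixteen_pow_rpow_half, pow_succ 2⁻¹]
        calc _ = 2⁻¹ ^ j * ((2 * 2⁻¹) * (ENNReal.ofReal s ^ (1 / 2 : ℝ) *
              (2⁻¹ ^ j * tail g (s / 16 ^ (j + 1))))) := by
              rw [ENNReal.mul_inv_cancel two_ne_zero ENNReal.ofNat_ne_top]; ring
          _ = _ := by ring
    _ ≤ _ := by gcongr

/- Hardy's inequality in disguise: the average of `g` near `0` is controlled by its tails. -/
theorem head_le_tailSup (hg : Measurable g) {s : ℝ} (hs : 0 < s) (hs1 : s ≤ 1) :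
    head g s ≤ 4 * (ENNReal.ofReal s ^ (1 / 2 : ℝ) * tailSup g s) :=
  calc head g s ≤ ∑' j : ℕ, ∫⁻ u in Set.Ioc (s / 16 ^ (j + 1)) (s / 16 ^ j), g u :=
        (lintegral_mono_set (Ioo_subset_iUnion_Ioc_div_pow (by norm_num) s)).trans
          (lintegral_iUnion_le _ _)
    _ ≤ ∑' j : ℕ, 2⁻¹ ^ j * (2 * (ENNReal.ofReal s ^ (1 / 2 : ℝ) * tailSup g s)) :=
        ENNReal.tsum_le_tsum (setLIntegral_Ioc_div_sixteen_pow_le hg hs hs1)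
    _ = 4 * (ENNReal.ofReal s ^ (1 / 2 : ℝ) * tailSup g s) := by
        rw [ENNReal.tsum_mul_right, ENNReal.tsum_geometric, ENNReal.one_sub_inv_two, inv_inv,
          ← mul_assoc]
        norm_num

theorem inv_mul_head_sq_le (hg : Measurable g) {s : ℝ} (hs : 0 < s) (hs1 : s ≤ 1) :
    (ENNReal.ofReal s)⁻¹ * head g s ^ 2 ≤ 16 * tailSup g s ^ 2 :=
  calc (ENNReal.ofReal s)⁻¹ * head g s ^ 2
      ≤ (ENNReal.ofReal s)⁻¹ * (4 * (ENNReal.ofReal s ^ (1 / 2 : ℝ) * tailSup g s)) ^ 2 := by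
        gcongr
        exact head_le_tailSup hg hs hs1
    _ = (ENNReal.ofReal s)⁻¹ * ENNReal.ofReal s * (16 * tailSup g s ^ 2) := by
        rw [mul_pow, mul_pow, rpow_half_sq]
        ring
    _ = 16 * tailSup g s ^ 2 := by
        rw [ENNReal.inv_mul_cancel (by simpa using hs) ENNReal.ofReal_ne_top, one_mul]

end Tail

section Weight

/-- The weight `t^{-1/q} (1 + |log t|)^α` common to both quasi-norms: `normLR` uses it on `(0, 1)`,
`normlL` at the positive integers. -/
noncomputable def weight (q : ℝ≥0∞) (α t : ℝ) : ℝ≥0∞ :=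
  ENNReal.ofReal (t ^ (-(q⁻¹).toReal) * (1 + |Real.log t|) ^ α)

/-- The constant in the comparison of the weight at an integer `K` with the weight on the interval
`(a / (K + 1), a / K)`. -/
noncomputable def dilationConst (q : ℝ≥0∞) (α a : ℝ) : ℝ≥0 :=
  (2 ^ (q⁻¹).toReal * (1 + Real.log (2 / a)) ^ (-α)).toNNReal

theorem weight_one (q : ℝ≥0∞) (α : ℝ) : weight q α 1 = 1 := by simp [weight]

theorem normlL_eq_eLpNorm_weight {ι : Type} (q : ℝ≥0∞) (α : ℝ) (c : ι → ℂ) :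
    normlL q α c = eLpNorm (fun k : ℕ => weight q α (k + 1) *
      (∑ i ∈ Finset.range (k + 1), seqRearr c i ^ 2) ^ (1 / 2 : ℝ)) q Measure.count := by
  have hlog (k : ℕ) : 0 ≤ Real.log ((k : ℝ) + 1) := Real.log_nonneg (by simp)
  simp only [normlL, weight, abs_of_nonneg (hlog _)]

theorem one_add_log_rpow_le_mul {α a K t : ℝ} (hα : α ≤ 0) (ha : 0 < a) (ha2 : a ≤ 2) (hK : 1 ≤ K)
    (ht : a / (2 * K) ≤ t) (ht1 : t ≤ 1) :
    (1 + Real.log K) ^ α ≤ (1 + Real.log (2 / a)) ^ (-α) * (1 + |Real.log t|) ^ α := by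
  have hK0 : 0 < K := one_pos.trans_le hK
  have ht0 : 0 < t := lt_of_lt_of_le (by positivity) ht
  have hlogK : 0 ≤ Real.log K := Real.log_nonneg hK
  have hloga : 0 ≤ Real.log (2 / a) := Real.log_nonneg ((one_le_div ha).2 ha2)
  have hlogt : |Real.log t| ≤ Real.log K + Real.log (2 / a) := by
    rw [abs_of_nonpos (Real.log_nonpos ht0.le ht1), ← Real.log_inv,
      ← Real.log_mul hK0.ne' (by positivity)]
    refine Real.log_le_log (by positivity) ?_
    rw [inv_le_comm₀ ht0 (by positivity)]
    refine (le_of_eq ?_).trans ht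
    field_simp
  have hprod : ((1 + Real.log K) * (1 + Real.log (2 / a))) ^ α ≤ (1 + |Real.log t|) ^ α :=
    Real.rpow_le_rpow_of_nonpos (by positivity) (by nlinarith) hα
  rw [Real.mul_rpow (by positivity) (by positivity)] at hprod
  rwa [Real.rpow_neg (by positivity), ← div_eq_inv_mul, le_div_iff₀ (by positivity)]

theorem rpow_neg_le_mul {e a K t : ℝ} (he : 0 ≤ e) (ha : 0 < a) (hK : 1 ≤ K) (ht : 0 < t)
    (htK : t ≤ a / K) : K ^ (-e) ≤ 2 ^ e * (a / K - a / (K + 1)) ^ e * t ^ (-e) := by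
  have hK0 : 0 < K := one_pos.trans_le hK
  have hlen : a / K - a / (K + 1) = a / (K * (K + 1)) := by field_simp; ring
  have hinv : K⁻¹ ≤ 2 * (a / (K * (K + 1))) * t⁻¹ := by
    rw [← div_eq_mul_inv, le_div_iff₀ ht]
    calc K⁻¹ * t ≤ K⁻¹ * (a / K) := by gcongr
      _ = 2 * (a / (K * (K + K))) := by field_simp; ring
      _ ≤ 2 * (a / (K * (K + 1))) := by gcongr
  rw [hlen, Real.rpow_neg hK0.le, Real.rpow_neg ht.le, ← Real.inv_rpow hK0.le,
    ← Real.inv_rpow ht.le, ← Real.mul_rpow (by positivity) (by positivity),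
    ← Real.mul_rpow (by positivity) (by positivity)]
  exact Real.rpow_le_rpow (by positivity) hinv he

theorem weight_le_dilationConst_mul (q : ℝ≥0∞) {α a K t : ℝ} (hα : α ≤ 0) (ha : 0 < a)
    (ha1 : a ≤ 1) (hK : 1 ≤ K) (ht : t ∈ Set.Ioo (a / (K + 1)) (a / K)) :
    weight q α K ≤
      dilationConst q α a * ENNReal.ofReal (a / K - a / (K + 1)) ^ (q⁻¹).toReal * weight q α t := by
  have hK0 : 0 < K := one_pos.trans_le hK
  have ht0 : 0 < t := lt_trans (by positivity) ht.1
  have ht1 : t ≤ 1 := ht.2.le.trans ((div_le_one hK0).2 (ha1.trans hK))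
  have htK : a / (2 * K) ≤ t := le_trans (by gcongr; linarith) ht.1.le
  have hlen : 0 ≤ a / K - a / (K + 1) := sub_nonneg.2 (by gcongr; linarith)
  have hloga : 0 ≤ Real.log (2 / a) := Real.log_nonneg ((one_le_div ha).2 (by linarith))
  rw [weight, weight, dilationConst, abs_of_nonneg (Real.log_nonneg hK), ← ENNReal.ofReal,
    ENNReal.ofReal_rpow_of_nonneg hlen ENNReal.toReal_nonneg,
    ← ENNReal.ofReal_mul (by positivity), ← ENNReal.ofReal_mul (by positivity)]
  refine ENNReal.ofReal_le_ofReal ?_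
  calc K ^ (-(q⁻¹).toReal) * (1 + Real.log K) ^ α
      ≤ (2 ^ (q⁻¹).toReal * (a / K - a / (K + 1)) ^ (q⁻¹).toReal * t ^ (-(q⁻¹).toReal)) *
          ((1 + Real.log (2 / a)) ^ (-α) * (1 + |Real.log t|) ^ α) :=
        mul_le_mul (rpow_neg_le_mul ENNReal.toReal_nonneg ha hK ht0 ht.2.le)
          (one_add_log_rpow_le_mul hα ha (by linarith) hK htK ht1)
          (by have := Real.log_nonneg hK; positivity) (by positivity)
    _ = _ := by ring

theorem eLpNorm_weight_mul_antitone_le (q : ℝ≥0∞) {α a : ℝ} {F : ℝ → ℝ≥0∞} (hF : Antitone F)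
    (hα : α ≤ 0) (ha : 0 < a) (ha1 : a ≤ 1) :
    eLpNorm (fun k : ℕ => weight q α (k + 1) * F (a / (k + 1))) q Measure.count ≤
      dilationConst q α a *
        eLpNorm (fun t => weight q α t * F t) q (volume.restrict (Set.Ioo (0 : ℝ) 1)) := by
  set I : ℕ → Set ℝ := fun k => Set.Ioo (a / (k + 1 + 1)) (a / (k + 1))
  have hpos (k : ℕ) : 0 < a / ((k : ℝ) + 1) - a / ((k : ℝ) + 1 + 1) :=
    sub_pos.2 (by gcongr; linarith)
  have hI (k : ℕ) : I k ⊆ Set.Ioo 0 1 :=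
    Set.Ioo_subset_Ioo (by positivity) (div_le_one_of_le₀ (by linarith [k.cast_nonneg (α := ℝ)])
      (by positivity))
  have hvol (k : ℕ) : volume.restrict (Set.Ioo (0 : ℝ) 1) (I k) =
      ENNReal.ofReal (a / (k + 1) - a / (k + 1 + 1)) := by
    rw [Measure.restrict_eq_self _ (hI k), Real.volume_Ioo]
  have hanti : Antitone fun k : ℕ => a / ((k : ℝ) + 1) := fun _ _ h => by dsimp only; gcongr
  refine eLpNorm_count_le_of_le_on_disjoint (I := I) (fun _ => measurableSet_Ioo)
    (by simpa [I, Order.succ_eq_add_one] using hanti.pairwise_disjoint_on_Ioo_succ)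
    (fun k => by simpa [hvol k] using hpos k) (fun k => by simp [hvol k]) fun k t ht => ?_
  rw [hvol k, ← mul_assoc]
  exact mul_le_mul' (weight_le_dilationConst_mul q hα ha ha1 (by simp) ht) (hF ht.2.le)

end Weight

section LogBounds

theorem exists_log_rpow_le_mul_pow {β b θ : ℝ} (hβ : 0 ≤ β) (hb : 1 ≤ b) (hθ : 1 < θ) :
    ∃ C : ℝ, ∀ (j : ℕ) (M : ℝ), 1 ≤ M →
      (1 + Real.log (2 * b ^ j * M ^ 2)) ^ β ≤ C * θ ^ j * (1 + Real.log M) ^ β := by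
  obtain ⟨m, hm⟩ := exists_nat_ge β
  obtain ⟨B, hB⟩ := (tendsto_pow_const_div_const_pow_of_one_lt m hθ).bddAbove_range
  set L := 2 + Real.log b
  have hlogb : 0 ≤ Real.log b := Real.log_nonneg hb
  have hpoly (j : ℕ) : ((j : ℝ) + 1) ^ β ≤ B * θ ^ (j + 1) := by
    have hj : ((j + 1 : ℕ) : ℝ) ^ m / θ ^ (j + 1) ≤ B := hB ⟨j + 1, rfl⟩
    rw [div_le_iff₀ (by positivity), ← Real.rpow_natCast] at hj
    push_cast at hj
    exact (Real.rpow_le_rpow_of_exponent_le (by simp) hm).trans hj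
  refine ⟨L ^ β * (B * θ), fun j M hM => ?_⟩
  have hlogM : 0 ≤ Real.log M := Real.log_nonneg hM
  have hlog2 : Real.log 2 ≤ 1 := by linarith [Real.log_two_lt_d9]
  have hlog : Real.log (2 * b ^ j * M ^ 2) = Real.log 2 + j * Real.log b + 2 * Real.log M := by
    rw [Real.log_mul (by positivity) (by positivity), Real.log_mul (by norm_num) (by positivity),
      Real.log_pow, Real.log_pow]
    norm_num
  have hj : (0 : ℝ) ≤ j := j.cast_nonneg
  calc (1 + Real.log (2 * b ^ j * M ^ 2)) ^ β
      ≤ (L * ((j : ℝ) + 1) * (1 + Real.log M)) ^ β := by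
        refine Real.rpow_le_rpow ?_ ?_ hβ
        · rw [hlog]; have := Real.log_nonneg one_le_two; positivity
        · rw [hlog]
          nlinarith [mul_nonneg hj hlogM, mul_nonneg hj hlogb, mul_nonneg hlogb hlogM,
            mul_nonneg (mul_nonneg hj hlogb) hlogM]
    _ = L ^ β * ((j : ℝ) + 1) ^ β * (1 + Real.log M) ^ β := by
        rw [Real.mul_rpow (by positivity) (by positivity),
          Real.mul_rpow (by positivity) (by positivity)]
    _ ≤ L ^ β * (B * θ ^ (j + 1)) * (1 + Real.log M) ^ β := by gcongr; exact hpoly j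
    _ = L ^ β * (B * θ) * θ ^ j * (1 + Real.log M) ^ β := by ring

theorem one_add_log_rpow_le {β M : ℝ} (hβ : 0 ≤ β) (hM : 1 ≤ M) :
    (1 + Real.log M) ^ β ≤ (1 + β) ^ β * M := by
  rcases hβ.eq_or_lt with rfl | hβ
  · simpa using hM
  have hM0 : 0 ≤ M := zero_le_one.trans hM
  have hlogM : 0 ≤ Real.log M := Real.log_nonneg hM
  have hlog : 1 + Real.log M ≤ (1 + β) * M ^ β⁻¹ := by
    have := Real.log_le_rpow_div hM0 (inv_pos.2 hβ)
    rw [div_inv_eq_mul] at this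
    linarith [Real.one_le_rpow hM (inv_nonneg.2 hβ.le)]
  calc (1 + Real.log M) ^ β ≤ ((1 + β) * M ^ β⁻¹) ^ β := by gcongr
    _ = (1 + β) ^ β * M := by
      rw [Real.mul_rpow (by positivity) (by positivity), Real.rpow_inv_rpow hM0 hβ.ne']

theorem one_add_log_rpow_le_mul_min {β M : ℝ} (hβ : 0 ≤ β) (hM : 1 ≤ M) :
    (1 + Real.log M) ^ β ≤ (1 + β) ^ β * min M ((1 + Real.log M) ^ β) := by
  have hlogM : 0 ≤ Real.log M := Real.log_nonneg hM
  rw [mul_min_of_nonneg _ _ (by positivity)]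
  exact le_min (one_add_log_rpow_le hβ hM)
    (le_mul_of_one_le_left (by positivity) (Real.one_le_rpow (by linarith) hβ))

end LogBounds


section Rearrangement

instance : IsProbabilityMeasure μ01 := ⟨by simp⟩

instance : IsProbabilityMeasure (volume.restrict (Set.Ioo (0 : ℝ) 1)) := ⟨by simp⟩

variable {f : ℝ → ℂ}

theorem rearr_le_iff {u : ℝ} {σ : ℝ≥0∞} :
    rearr f u ≤ σ ↔ μ01 {x | σ < ‖f x‖ₑ} ≤ ENNReal.ofReal u := by
  refine ⟨fun h => ?_, fun h => sInf_le h⟩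
  rcases eq_or_ne σ ∞ with rfl | hσ
  · simp
  obtain ⟨v, hv, hvσ, hvlim⟩ := exists_seq_strictAnti_tendsto' hσ.lt_top
  have hUnion : {x | σ < ‖f x‖ₑ} = ⋃ n, {x | v n < ‖f x‖ₑ} := by
    ext x
    simp only [Set.mem_ofPred_eq, Set.mem_iUnion]
    exact ⟨fun hx => (hvlim.eventually_lt_const hx).exists, fun ⟨n, hn⟩ => (hvσ n).1.trans hn⟩
  have hmono : Monotone fun n => {x | v n < ‖f x‖ₑ} := fun _ _ hmn _ hx =>
    (hv.antitone hmn).trans_lt hx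
  rw [hUnion, hmono.measure_iUnion]
  refine iSup_le fun n => ?_
  obtain ⟨s, hs, hsv⟩ := sInf_lt_iff.1 (h.trans_lt (hvσ n).1)
  exact (measure_mono fun x (hx : v n < ‖f x‖ₑ) => hsv.trans hx).trans hs

theorem rearr_antitone (f : ℝ → ℂ) : Antitone (rearr f) := fun _ _ h =>
  sInf_le_sInf fun _ hs => le_trans hs (ENNReal.ofReal_le_ofReal h)

theorem measurable_rearr (f : ℝ → ℂ) : Measurable (rearr f) := (rearr_antitone f).measurable

theorem volume_restrict_lt_rearr (f : ℝ → ℂ) (σ : ℝ≥0∞) :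
    volume.restrict (Set.Ioo (0 : ℝ) 1) {u | σ < rearr f u} = μ01 {x | σ < ‖f x‖ₑ} := by
  set D := μ01 {x | σ < ‖f x‖ₑ}
  have hD : D ≤ 1 := prob_le_one
  have hDtop : D ≠ ∞ := ne_top_of_le_ne_top ENNReal.one_ne_top hD
  have hset : {u | σ < rearr f u} ∩ Set.Ioo (0 : ℝ) 1 = Set.Ioo 0 D.toReal := by
    ext u
    have hlt : σ < rearr f u ↔ ENNReal.ofReal u < D := by
      rw [← not_le, rearr_le_iff, not_le]
    simp only [Set.mem_inter_iff, Set.mem_ofPred_eq, Set.mem_Ioo, hlt]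
    constructor
    · rintro ⟨h, h0, -⟩
      exact ⟨h0, (ENNReal.ofReal_lt_iff_lt_toReal h0.le hDtop).1 h⟩
    · rintro ⟨h0, h⟩
      exact ⟨(ENNReal.ofReal_lt_iff_lt_toReal h0.le hDtop).2 h, h0,
        h.trans_le (ENNReal.toReal_mono ENNReal.one_ne_top hD)⟩
  rw [Measure.restrict_apply (measurableSet_lt measurable_const (measurable_rearr f)), hset,
    Real.volume_Ioo, sub_zero, ENNReal.ofReal_toReal hDtop]

theorem map_enorm_eq_map_rearr (hf : AEStronglyMeasurable f μ01) :
    Measure.map (fun x => ‖f x‖ₑ) μ01 =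
      Measure.map (rearr f) (volume.restrict (Set.Ioo (0 : ℝ) 1)) := by
  have := Measure.isProbabilityMeasure_map hf.enorm
  have := Measure.isProbabilityMeasure_map
    (measurable_rearr f).aemeasurable (μ := volume.restrict (Set.Ioo (0 : ℝ) 1))
  refine Measure.ext_of_Iic _ _ fun σ => ?_
  rw [← Set.compl_Ioi, prob_compl_eq_one_sub measurableSet_Ioi,
    prob_compl_eq_one_sub measurableSet_Ioi,
    Measure.map_apply_of_aemeasurable hf.enorm measurableSet_Ioi,
    Measure.map_apply (measurable_rearr f) measurableSet_Ioi]
  congr 1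
  exact (volume_restrict_lt_rearr f σ).symm

theorem setLIntegral_enorm_eq_setLIntegral_rearr (hf : AEStronglyMeasurable f μ01)
    {S : Set ℝ≥0∞} (hS : MeasurableSet S) {G : ℝ≥0∞ → ℝ≥0∞} (hG : Measurable G) :
    ∫⁻ x in {x | ‖f x‖ₑ ∈ S}, G ‖f x‖ₑ ∂μ01 =
      ∫⁻ u in {u | rearr f u ∈ S} ∩ Set.Ioo 0 1, G (rearr f u) := by
  have hrearr := measurable_rearr f
  calc ∫⁻ x in {x | ‖f x‖ₑ ∈ S}, G ‖f x‖ₑ ∂μ01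
      = ∫⁻ y in S, G y ∂Measure.map (fun x => ‖f x‖ₑ) μ01 := by
        rw [Measure.restrict_map_of_aemeasurable hf.enorm hS,
          lintegral_map' hG.aemeasurable hf.enorm.restrict]
        rfl
    _ = ∫⁻ u in {u | rearr f u ∈ S} ∩ Set.Ioo 0 1, G (rearr f u) := by
        rw [map_enorm_eq_map_rearr hf, setLIntegral_map hS hG hrearr,
          Measure.restrict_restrict (hrearr hS)]
        rfl

theorem lintegral_enorm_eq_head (hf : AEStronglyMeasurable f μ01) :
    ∫⁻ x, ‖f x‖ₑ ∂μ01 = head (rearr f) 1 := by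
  simpa [head] using setLIntegral_enorm_eq_setLIntegral_rearr hf .univ measurable_id

theorem setLIntegral_rearr_lt_enorm_le_head (hf : AEStronglyMeasurable f μ01) (s : ℝ) :
    ∫⁻ x in {x | rearr f s < ‖f x‖ₑ}, ‖f x‖ₑ ∂μ01 ≤ head (rearr f) s := by
  refine (setLIntegral_enorm_eq_setLIntegral_rearr hf measurableSet_Ioi measurable_id).trans_le
    (lintegral_mono_set ?_)
  rintro u ⟨hu, hu0, -⟩
  exact ⟨hu0, (rearr_antitone f).reflect_lt hu⟩

theorem ofReal_mul_rearr_le_head (f : ℝ → ℂ) (s : ℝ) :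
    ENNReal.ofReal s * rearr f s ≤ head (rearr f) s :=
  calc ENNReal.ofReal s * rearr f s = ∫⁻ _ in Set.Ioo 0 s, rearr f s := by
        rw [setLIntegral_const, Real.volume_Ioo, sub_zero, mul_comm]
    _ ≤ head (rearr f) s :=
        setLIntegral_mono' measurableSet_Ioo fun _ hu => rearr_antitone f hu.2.le

theorem setLIntegral_enorm_le_rearr_sq_le (hf : AEStronglyMeasurable f μ01) {s : ℝ} (hs : 0 < s) :
    ∫⁻ x in {x | ‖f x‖ₑ ≤ rearr f s}, ‖f x‖ₑ ^ 2 ∂μ01 ≤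
      (ENNReal.ofReal s)⁻¹ * head (rearr f) s ^ 2 + tail (rearr f) s ^ 2 := by
  have hs0 : ENNReal.ofReal s ≠ 0 := by simpa using hs
  have hcover : {u | rearr f u ≤ rearr f s} ∩ Set.Ioo 0 1 ⊆
      {u | rearr f u ≤ rearr f s} ∩ Set.Ioc 0 s ∪ Set.Ioo s 1 := fun u ⟨hu, hu0, hu1⟩ =>
    (le_or_gt u s).imp (fun h => ⟨hu, hu0, h⟩) fun h => ⟨h, hu1⟩
  have hlow : ∫⁻ u in {u | rearr f u ≤ rearr f s} ∩ Set.Ioc 0 s, rearr f u ^ 2 ≤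
      (ENNReal.ofReal s)⁻¹ * head (rearr f) s ^ 2 :=
    calc ∫⁻ u in {u | rearr f u ≤ rearr f s} ∩ Set.Ioc 0 s, rearr f u ^ 2
        ≤ ∫⁻ _ in {u | rearr f u ≤ rearr f s} ∩ Set.Ioc 0 s, rearr f s ^ 2 := by
          refine setLIntegral_mono measurable_const fun u hu => ?_
          gcongr
          exact hu.1
      _ ≤ ∫⁻ _ in Set.Ioc 0 s, rearr f s ^ 2 := lintegral_mono_set Set.inter_subset_right
      _ = (ENNReal.ofReal s)⁻¹ * (ENNReal.ofReal s * rearr f s) ^ 2 := by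
          rw [setLIntegral_const, Real.volume_Ioc, sub_zero, mul_pow, sq (ENNReal.ofReal s),
            mul_assoc, ENNReal.inv_mul_cancel_left hs0 ENNReal.ofReal_ne_top, mul_comm]
      _ ≤ (ENNReal.ofReal s)⁻¹ * head (rearr f) s ^ 2 := by
          gcongr
          exact ofReal_mul_rearr_le_head f s
  calc ∫⁻ x in {x | ‖f x‖ₑ ≤ rearr f s}, ‖f x‖ₑ ^ 2 ∂μ01
      = ∫⁻ u in {u | rearr f u ≤ rearr f s} ∩ Set.Ioo 0 1, rearr f u ^ 2 :=
        setLIntegral_enorm_eq_setLIntegral_rearr hf measurableSet_Iic (measurable_id.pow_const 2)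
    _ ≤ _ := (lintegral_mono_set hcover).trans (lintegral_union_le _ _ _)
    _ ≤ _ := add_le_add hlow (tail_sq _ s).ge

end Rearrangement

section SequenceRearrangement

variable {ι : Type} {a b : ι → ℂ}

theorem seqRearr_le_of_forall_le {B : ℝ≥0∞} (h : ∀ n, ‖a n‖ₑ ≤ B) (k : ℕ) : seqRearr a k ≤ B := by
  refine sInf_le ?_
  have hempty : {n | B < ‖a n‖ₑ} = ∅ := Set.eq_empty_of_forall_notMem fun n => not_lt.2 (h n)
  simp [hempty]

theorem exists_notMem_seqRearr_half_lt_enorm {k : ℕ} (h0 : seqRearr a k ≠ 0)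
    (htop : seqRearr a k ≠ ∞) {T : Finset ι} (hT : T.card ≤ k) :
    ∃ n ∉ T, seqRearr a k / 2 < ‖a n‖ₑ := by
  by_contra! h
  have hsub : {n | seqRearr a k / 2 < ‖a n‖ₑ} ⊆ T := fun n hn => by
    by_contra hnT
    exact not_lt.2 (h n hnT) hn
  have hcard : Set.encard {n | seqRearr a k / 2 < ‖a n‖ₑ} ≤ k :=
    (Set.encard_le_encard hsub).trans (by simpa using hT)
  exact not_lt.2 (sInf_le hcard : seqRearr a k ≤ seqRearr a k / 2) (ENNReal.half_lt_self h0 htop)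

/- Greedy choice: as long as `c*_{k+1} ≠ 0`, more than `k` terms exceed `c*_{k+1} / 2`, so one of
them is still unused after `k` choices. -/
theorem exists_finset_sum_seqRearr_sq_le (ha : ∀ i, seqRearr a i ≠ ∞) (k : ℕ) :
    ∃ T : Finset ι, T.card ≤ k ∧
      ∑ i ∈ Finset.range k, seqRearr a i ^ 2 ≤ 4 * ∑ n ∈ T, ‖a n‖ₑ ^ 2 := by
  classical
  induction k with
  | zero => exact ⟨∅, by simp, by simp⟩
  | succ k ih =>
    obtain ⟨T, hT, hsum⟩ := ih
    rw [Finset.sum_range_succ]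
    rcases eq_or_ne (seqRearr a k) 0 with h0 | h0
    · exact ⟨T, hT.trans k.le_succ, by simpa [h0] using hsum⟩
    obtain ⟨n, hnT, hn⟩ := exists_notMem_seqRearr_half_lt_enorm h0 (ha k) hT
    refine ⟨insert n T, (Finset.card_insert_le _ _).trans (by lia), ?_⟩
    rw [Finset.sum_insert hnT, mul_add, add_comm]
    refine add_le_add ?_ hsum
    calc seqRearr a k ^ 2 = 4 * (seqRearr a k / 2) ^ 2 := by
          rw [show (4 : ℝ≥0∞) = 2 ^ 2 by norm_num, ← mul_pow,
            ENNReal.mul_div_cancel two_ne_zero ENNReal.ofNat_ne_top]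
      _ ≤ 4 * ‖a n‖ₑ ^ 2 := by gcongr

theorem sum_seqRearr_sq_le (a : ι → ℂ) (k : ℕ) :
    ∑ i ∈ Finset.range k, seqRearr a i ^ 2 ≤ 4 * ∑' n, ‖a n‖ₑ ^ 2 := by
  rcases eq_or_ne (∑' n, ‖a n‖ₑ ^ 2) ∞ with htop | hfin
  · simp [htop]
  have hb (n) : ‖a n‖ₑ ≤ (∑' n, ‖a n‖ₑ ^ 2) ^ (1 / 2 : ℝ) := by
    rw [one_div, ENNReal.le_rpow_inv_iff two_pos, ENNReal.rpow_two]
    exact ENNReal.le_tsum n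
  have hne (i) : seqRearr a i ≠ ∞ := ne_top_of_le_ne_top
    (ENNReal.rpow_ne_top_of_nonneg (by norm_num) hfin) (seqRearr_le_of_forall_le hb i)
  obtain ⟨T, -, hT⟩ := exists_finset_sum_seqRearr_sq_le hne k
  exact hT.trans (by gcongr; exact ENNReal.sum_le_tsum T)

theorem seqRearr_add_le {B : ℝ≥0∞} (hb : ∀ n, ‖b n‖ₑ ≤ B) (k : ℕ) :
    seqRearr (a + b) k ≤ seqRearr a k + B := by
  rw [seqRearr, seqRearr, ENNReal.sInf_add]
  refine le_iInf₂ fun s hs => sInf_le ((Set.encard_le_encard fun n hn => ?_).trans hs)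
  by_contra! h
  exact not_lt.2 ((enorm_add_le _ _).trans (add_le_add (not_lt.1 h) (hb n))) hn

theorem sum_seqRearr_add_sq_le {B : ℝ≥0∞} (hb : ∀ n, ‖b n‖ₑ ≤ B) (k : ℕ) :
    ∑ i ∈ Finset.range k, seqRearr (a + b) i ^ 2 ≤
      8 * ∑' n, ‖a n‖ₑ ^ 2 + 2 * (k * B ^ 2) := by
  have hterm (i) : seqRearr (a + b) i ^ 2 ≤ 2 * seqRearr a i ^ 2 + 2 * B ^ 2 :=
    calc seqRearr (a + b) i ^ 2 ≤ (seqRearr a i + B) ^ 2 := by gcongr; exact seqRearr_add_le hb i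
      _ ≤ 2 * seqRearr a i ^ 2 + 2 * B ^ 2 := by
        have := ENNReal.rpow_add_le_mul_rpow_add_rpow (seqRearr a i) B (p := 2) (by norm_num)
        norm_num at this
        rwa [mul_add] at this
  calc ∑ i ∈ Finset.range k, seqRearr (a + b) i ^ 2
      ≤ ∑ i ∈ Finset.range k, (2 * seqRearr a i ^ 2 + 2 * B ^ 2) :=
        Finset.sum_le_sum fun i _ => hterm i
    _ = 2 * ∑ i ∈ Finset.range k, seqRearr a i ^ 2 + 2 * (k * B ^ 2) := by
        rw [Finset.sum_add_distrib, ← Finset.mul_sum, Finset.sum_const, Finset.card_range,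
          nsmul_eq_mul, mul_left_comm]
    _ ≤ 2 * (4 * ∑' n, ‖a n‖ₑ ^ 2) + 2 * (k * B ^ 2) := by
        gcongr
        exact sum_seqRearr_sq_le a k
    _ = 8 * ∑' n, ‖a n‖ₑ ^ 2 + 2 * (k * B ^ 2) := by ring

end SequenceRearrangement

section FourierCoefficients

/-- A family in an inner product space satisfying Bessel's inequality with constant one, stated
through finite partial sums. -/
def IsBesselFamily (𝕜 : Type*) {ι E : Type*} [RCLike 𝕜] [NormedAddCommGroup E]
    [InnerProductSpace 𝕜 E] (φ : ι → E) : Prop :=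
  ∀ (g : E) (T : Finset ι), ∑ n ∈ T, ‖inner 𝕜 (φ n) g‖ ^ 2 ≤ ‖g‖ ^ 2

variable {ι : Type} {φ : ι → Lp ℂ 2 μ01} {M : ℝ≥0} {f : ℝ → ℂ}

theorem one_le_of_norm_eq_one {p : ℝ≥0∞} {ψ : Lp ℂ p μ01} (hψ : ‖ψ‖ = 1)
    (hM : eLpNorm ψ ∞ μ01 ≤ M) : 1 ≤ M := by
  have hp : eLpNorm ψ p μ01 = 1 := by
    rwa [Lp.norm_def, ENNReal.toReal_eq_one_iff] at hψ
  have hle : (1 : ℝ≥0∞) ≤ M :=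
    hp.symm.trans_le ((eLpNorm_le_eLpNorm_of_exponent_le le_top ψ.1.aestronglyMeasurable).trans hM)
  exact_mod_cast hle

theorem integrable_mul_conj (hM : ∀ n, eLpNorm (φ n) ∞ μ01 ≤ M) (hf : Integrable f μ01) (n : ι) :
    Integrable (fun x => f x * conj (φ n x)) μ01 :=
  hf.mul_of_top_left
    (MemLp.star ⟨Lp.aestronglyMeasurable (φ n), (hM n).trans_lt ENNReal.coe_lt_top⟩)

theorem enorm_fourierCoeffs_le (hM : ∀ n, eLpNorm (φ n) ∞ μ01 ≤ M) (f : ℝ → ℂ) (n : ι) :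
    ‖fourierCoeffs φ f n‖ₑ ≤ M * ∫⁻ x, ‖f x‖ₑ ∂μ01 := by
  have hφ : ∀ᵐ x ∂μ01, ‖φ n x‖ₑ ≤ M := by
    filter_upwards [enorm_ae_le_eLpNormEssSup (φ n) μ01] with x hx
    exact hx.trans (eLpNorm_exponent_top.symm.trans_le (hM n))
  calc ‖fourierCoeffs φ f n‖ₑ ≤ ∫⁻ x, ‖f x * conj (φ n x)‖ₑ ∂μ01 :=
        enorm_integral_le_lintegral_enorm _
    _ ≤ ∫⁻ x, M * ‖f x‖ₑ ∂μ01 := by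
        refine lintegral_mono_ae ?_
        filter_upwards [hφ] with x hx
        rw [enorm_mul, RCLike.enorm_conj, mul_comm]
        gcongr
    _ = M * ∫⁻ x, ‖f x‖ₑ ∂μ01 := lintegral_const_mul' _ _ ENNReal.coe_ne_top

theorem fourierCoeffs_add (hM : ∀ n, eLpNorm (φ n) ∞ μ01 ≤ M) {g h : ℝ → ℂ}
    (hg : Integrable g μ01) (hh : Integrable h μ01) :
    fourierCoeffs φ (g + h) = fourierCoeffs φ g + fourierCoeffs φ h := by
  funext n
  simp only [fourierCoeffs, Pi.add_apply, add_mul]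
  exact integral_add (integrable_mul_conj hM hg n) (integrable_mul_conj hM hh n)

theorem fourierCoeffs_eq_inner (φ : ι → Lp ℂ 2 μ01) (hf : MemLp f 2 μ01) (n : ι) :
    fourierCoeffs φ f n = inner ℂ (φ n) (hf.toLp f) := by
  rw [L2.inner_def, fourierCoeffs]
  refine integral_congr_ae ?_
  filter_upwards [hf.coeFn_toLp] with x hx
  rw [hx, RCLike.inner_apply]

theorem tsum_enorm_fourierCoeffs_sq_le (hφ : IsBesselFamily ℂ φ)
    (hf : AEStronglyMeasurable f μ01) :
    ∑' n, ‖fourierCoeffs φ f n‖ₑ ^ 2 ≤ ∫⁻ x, ‖f x‖ₑ ^ 2 ∂μ01 := by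
  have hnorm : eLpNorm f 2 μ01 ^ 2 = ∫⁻ x, ‖f x‖ₑ ^ 2 ∂μ01 := by
    simpa using eLpNorm_nnreal_pow_eq_lintegral (f := f) (μ := μ01) (p := 2) two_ne_zero
  rw [← hnorm]
  rcases eq_or_ne (eLpNorm f 2 μ01) ∞ with htop | hfin
  · simp [htop]
  have hf2 : MemLp f 2 μ01 := ⟨hf, hfin.lt_top⟩
  refine ENNReal.summable.tsum_le_of_sum_le fun T => ?_
  have hT := ENNReal.ofReal_le_ofReal (hφ (hf2.toLp f) T)
  rw [ENNReal.ofReal_sum_of_nonneg fun _ _ => by positivity] at hT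
  simpa only [fourierCoeffs_eq_inner φ hf2, ENNReal.ofReal_pow (norm_nonneg _), ofReal_norm,
    Lp.enorm_toLp] using hT

theorem sum_seqRearr_fourierCoeffs_sq_le (hφ : IsBesselFamily ℂ φ)
    (hM : ∀ n, eLpNorm (φ n) ∞ μ01 ≤ M) (hf : Integrable f μ01) {s : ℝ} (hs : 0 < s) (k : ℕ) :
    ∑ i ∈ Finset.range k, seqRearr (fourierCoeffs φ f) i ^ 2 ≤
      8 * ((ENNReal.ofReal s)⁻¹ * head (rearr f) s ^ 2 + tail (rearr f) s ^ 2) +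
        2 * (k * (M * head (rearr f) s) ^ 2) := by
  set E := {x | ‖f x‖ₑ ≤ rearr f s}
  have hE : NullMeasurableSet E μ01 := hf.1.enorm.nullMeasurable measurableSet_Iic
  have hEc : Eᶜ = {x | rearr f s < ‖f x‖ₑ} := by ext; simp [E]
  have hsmall : ∑' n, ‖fourierCoeffs φ (E.indicator f) n‖ₑ ^ 2 ≤
      (ENNReal.ofReal s)⁻¹ * head (rearr f) s ^ 2 + tail (rearr f) s ^ 2 :=
    calc _ ≤ ∫⁻ x, ‖E.indicator f x‖ₑ ^ 2 ∂μ01 :=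
          tsum_enorm_fourierCoeffs_sq_le hφ (hf.indicator₀ hE).1
      _ = ∫⁻ x in E, ‖f x‖ₑ ^ 2 ∂μ01 := by
          rw [← lintegral_indicator₀ hE]
          refine lintegral_congr fun x => ?_
          by_cases hx : x ∈ E <;> simp [hx]
      _ ≤ _ := setLIntegral_enorm_le_rearr_sq_le hf.1 hs
  have hlarge (n) : ‖fourierCoeffs φ (Eᶜ.indicator f) n‖ₑ ≤ M * head (rearr f) s :=
    calc _ ≤ M * ∫⁻ x, ‖Eᶜ.indicator f x‖ₑ ∂μ01 := enorm_fourierCoeffs_le hM _ n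
      _ = M * ∫⁻ x in {x | rearr f s < ‖f x‖ₑ}, ‖f x‖ₑ ∂μ01 := by
          rw [← hEc, ← lintegral_indicator₀ hE.compl]
          simp only [enorm_indicator_eq_indicator_enorm]
      _ ≤ M * head (rearr f) s := by
          gcongr
          exact setLIntegral_rearr_lt_enorm_le_head hf.1 s
  have hsplit : fourierCoeffs φ f =
      fourierCoeffs φ (E.indicator f) + fourierCoeffs φ (Eᶜ.indicator f) := by
    rw [← fourierCoeffs_add hM (hf.indicator₀ hE) (hf.indicator₀ hE.compl),
      Set.indicator_self_add_compl]
  rw [hsplit]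
  exact (sum_seqRearr_add_sq_le hlarge k).trans (by gcongr)

end FourierCoefficients

section PartialSums

theorem inv_ofReal_one_div_sq_div {M : ℝ≥0} (hM : 0 < M) (k : ℕ) :
    (ENNReal.ofReal (1 / M ^ 2 / (k + 1)))⁻¹ = ((k + 1 : ℕ) : ℝ≥0∞) * M ^ 2 := by
  have hk : (1 / (M : ℝ) ^ 2 / (k + 1))⁻¹ = ((k + 1 : ℕ) : ℝ) * M ^ 2 := by
    push_cast
    rw [div_div, one_div, inv_inv, mul_comm]
  rw [← ENNReal.ofReal_inv_of_pos (by positivity), hk, ENNReal.ofReal_mul (by positivity),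
    ENNReal.ofReal_natCast, ENNReal.ofReal_pow M.coe_nonneg, ENNReal.ofReal_coe_nnreal]

theorem sum_seqRearr_fourierCoeffs_rpow_half_le {ι : Type} {φ : ι → Lp ℂ 2 μ01} {M : ℝ≥0}
    {f : ℝ → ℂ} (hM1 : 1 ≤ M) (hφ : IsBesselFamily ℂ φ) (hM : ∀ n, eLpNorm (φ n) ∞ μ01 ≤ M)
    (hf : Integrable f μ01) (k : ℕ) :
    (∑ i ∈ Finset.range (k + 1), seqRearr (fourierCoeffs φ f) i ^ 2) ^ (1 / 2 : ℝ) ≤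
      13 * tailSup (rearr f) (1 / M ^ 2 / (k + 1)) := by
  set s : ℝ := 1 / M ^ 2 / (k + 1)
  have hM0 : 0 < M := one_pos.trans_le hM1
  have hs : 0 < s := by positivity
  have hs1 : s ≤ 1 := div_le_one_of_le₀
    ((div_le_one_of_le₀ (one_le_pow₀ (by exact_mod_cast hM1)) (by positivity)).trans (by simp))
    (by positivity)
  have hhead : (ENNReal.ofReal s)⁻¹ * head (rearr f) s ^ 2 ≤ 16 * tailSup (rearr f) s ^ 2 :=
    inv_mul_head_sq_le (measurable_rearr f) hs hs1
  have hcount : ((k + 1 : ℕ) : ℝ≥0∞) * (M * head (rearr f) s) ^ 2 =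
      (ENNReal.ofReal s)⁻¹ * head (rearr f) s ^ 2 := by
    rw [inv_ofReal_one_div_sq_div hM0, mul_pow, mul_assoc]
  refine rpow_half_le_of_le_sq ?_
  calc ∑ i ∈ Finset.range (k + 1), seqRearr (fourierCoeffs φ f) i ^ 2
      ≤ 8 * ((ENNReal.ofReal s)⁻¹ * head (rearr f) s ^ 2 + tail (rearr f) s ^ 2) +
          2 * ((ENNReal.ofReal s)⁻¹ * head (rearr f) s ^ 2) :=
        hcount ▸ sum_seqRearr_fourierCoeffs_sq_le hφ hM hf hs (k + 1)
    _ ≤ 8 * (16 * tailSup (rearr f) s ^ 2 + tailSup (rearr f) s ^ 2) +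
          2 * (16 * tailSup (rearr f) s ^ 2) := by
        gcongr
        exact tail_le_tailSup _ s
    _ = 168 * tailSup (rearr f) s ^ 2 := by ring
    _ ≤ 13 ^ 2 * tailSup (rearr f) s ^ 2 := by gcongr; norm_num
    _ = (13 * tailSup (rearr f) s) ^ 2 := (mul_pow _ _ _).symm

end PartialSums

section WeightedTailSup

variable {α : ℝ}

/- The growth of `dilationConst` in `j` is only logarithmic in `16 ^ j`, so the damping `2⁻ʲ` in
`tailSup` turns it into geometric decay. -/
theorem exists_dilationConst_le (q : ℝ≥0∞) (hα : α ≤ 0) :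
    ∃ C : ℝ≥0, ∀ (j : ℕ) (M : ℝ), 1 ≤ M →
      2⁻¹ ^ j * (dilationConst q α (1 / M ^ 2 / 16 ^ j) : ℝ≥0∞) ≤
        (3 / 4) ^ j * (C * ENNReal.ofReal ((1 + Real.log M) ^ (-α))) := by
  obtain ⟨C, hC⟩ := exists_log_rpow_le_mul_pow (neg_nonneg.2 hα) (b := 16) (θ := 3 / 2)
    (by norm_num) (by norm_num)
  refine ⟨(2 ^ (q⁻¹).toReal * C).toNNReal, fun j M hM => ?_⟩
  have hlogM : 0 ≤ Real.log M := Real.log_nonneg hM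
  have harg : 2 / (1 / M ^ 2 / 16 ^ j) = 2 * 16 ^ j * M ^ 2 := by field_simp
  have hpow (x : ℝ) (hx : 0 ≤ x) : ENNReal.ofReal x ^ j = ENNReal.ofReal (x ^ j) :=
    (ENNReal.ofReal_pow hx j).symm
  have h2 : (2⁻¹ : ℝ≥0∞) = ENNReal.ofReal 2⁻¹ := by
    rw [ENNReal.ofReal_inv_of_pos two_pos, ENNReal.ofReal_ofNat]
  have h34 : (3 / 4 : ℝ≥0∞) = ENNReal.ofReal (3 / 4) := by
    rw [ENNReal.ofReal_div_of_pos four_pos, ENNReal.ofReal_ofNat, ENNReal.ofReal_ofNat]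
  rw [h2, h34, hpow _ (by norm_num), hpow _ (by norm_num), dilationConst, harg, ← ENNReal.ofReal,
    ← ENNReal.ofReal, ← ENNReal.ofReal_mul (by positivity),
    ← ENNReal.ofReal_mul' (q := (1 + Real.log M) ^ (-α)) (by positivity),
    ← ENNReal.ofReal_mul (by positivity)]
  refine ENNReal.ofReal_le_ofReal ?_
  calc 2⁻¹ ^ j * (2 ^ (q⁻¹).toReal * (1 + Real.log (2 * 16 ^ j * M ^ 2)) ^ (-α))
      ≤ 2⁻¹ ^ j * (2 ^ (q⁻¹).toReal * (C * (3 / 2) ^ j * (1 + Real.log M) ^ (-α))) := by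
        gcongr
        exact hC j M hM
    _ = (2⁻¹ * (3 / 2)) ^ j * (2 ^ (q⁻¹).toReal * C * (1 + Real.log M) ^ (-α)) := by
        rw [mul_pow]
        ring
    _ = _ := by norm_num

theorem exists_eLpNorm_tailSup_le (q : ℝ≥0∞) (hα : α ≤ 0) :
    ∃ C : ℝ≥0, ∀ (g : ℝ → ℝ≥0∞) (M : ℝ), 1 ≤ M →
      eLpNorm (fun k : ℕ => weight q α (k + 1) * tailSup g (1 / M ^ 2 / (k + 1))) q
          Measure.count ≤
        C * (ENNReal.ofReal ((1 + Real.log M) ^ (-α)) *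
          eLpNorm (fun t => weight q α t * tail g t) q (volume.restrict (Set.Ioo (0 : ℝ) 1))) := by
  have hratio : (3 / 4 : ℝ≥0∞) < 1 := by
    rw [ENNReal.div_lt_iff (by simp) (by simp)]
    norm_num
  obtain ⟨C₁, hC₁⟩ := exists_eLpNorm_iSup_le_of_geometric (μ := (Measure.count : Measure ℕ)) q
    hratio
  obtain ⟨C₂, hC₂⟩ := exists_dilationConst_le q hα
  refine ⟨C₁ * C₂, fun g M hM => ?_⟩
  set N := eLpNorm (fun t => weight q α t * tail g t) q (volume.restrict (Set.Ioo (0 : ℝ) 1))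
  set G : ℕ → ℕ → ℝ≥0∞ := fun j k => weight q α (k + 1) * tail g (1 / M ^ 2 / 16 ^ j / (k + 1))
  have hsup : (fun k : ℕ => weight q α (k + 1) * tailSup g (1 / M ^ 2 / (k + 1))) =
      fun k => ⨆ j, 2⁻¹ ^ j * G j k := by
    funext k
    simp only [tailSup, ENNReal.mul_iSup, G, mul_left_comm, div_right_comm _ ((k : ℝ) + 1)]
  have hG (j : ℕ) : eLpNorm (G j) q Measure.count ≤ dilationConst q α (1 / M ^ 2 / 16 ^ j) * N :=
    eLpNorm_weight_mul_antitone_le q (tail_antitone g) hα (by positivity)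
      (div_le_one_of_le₀ ((div_le_one_of_le₀ (one_le_pow₀ hM) (by positivity)).trans
        (one_le_pow₀ (by norm_num))) (by positivity))
  have hscale (j : ℕ) : eLpNorm (fun k => 2⁻¹ ^ j * G j k) q Measure.count ≤
      2⁻¹ ^ j * eLpNorm (G j) q Measure.count := by
    have hcoe : ((2⁻¹ ^ j : ℝ≥0) : ℝ≥0∞) = 2⁻¹ ^ j := by simp [ENNReal.inv_pow]
    rw [← hcoe]
    exact eLpNorm_le_mul_eLpNorm_of_ae_le_mul' (.of_forall fun _ => le_rfl) q
  rw [hsup, ENNReal.coe_mul, mul_assoc, ← mul_assoc (C₂ : ℝ≥0∞)]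
  refine hC₁ _ _ (fun j => measurable_from_nat.aemeasurable) fun j => ?_
  calc eLpNorm (fun k => 2⁻¹ ^ j * G j k) q Measure.count
      ≤ 2⁻¹ ^ j * (dilationConst q α (1 / M ^ 2 / 16 ^ j) * N) :=
        (hscale j).trans (by gcongr; exact hG j)
    _ ≤ (3 / 4) ^ j * (C₂ * ENNReal.ofReal ((1 + Real.log M) ^ (-α)) * N) := by
        rw [← mul_assoc, ← mul_assoc]
        gcongr ?_ * N
        exact hC₂ j M hM

theorem MemLR.integrable {q : ℝ≥0∞} (hq : 0 < q) (hα : α ≤ 0) {f : ℝ → ℂ} (hf : MemLR q α f) :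
    Integrable f μ01 := by
  obtain ⟨C, hC⟩ := exists_eLpNorm_tailSup_le q hα
  have hfirst := enorm_le_eLpNorm_count
    (fun k : ℕ => weight q α (k + 1) * tailSup (rearr f) (1 / 1 ^ 2 / (k + 1))) 0 hq.ne'
  have htop : tailSup (rearr f) 1 < ∞ := by
    calc tailSup (rearr f) 1 ≤ C * eLpNorm (fun t => weight q α t * tail (rearr f) t) q
            (volume.restrict (Set.Ioo (0 : ℝ) 1)) := by
          simpa [weight_one] using hfirst.trans (hC (rearr f) 1 le_rfl)
      _ < ∞ := ENNReal.mul_lt_top ENNReal.coe_lt_top hf.2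
  refine ⟨hf.1, ?_⟩
  calc ∫⁻ x, ‖f x‖ₑ ∂μ01 = head (rearr f) 1 := lintegral_enorm_eq_head hf.1
    _ ≤ 4 * (ENNReal.ofReal 1 ^ (1 / 2 : ℝ) * tailSup (rearr f) 1) :=
        head_le_tailSup (measurable_rearr f) one_pos le_rfl
    _ < ∞ := by simpa using ENNReal.mul_lt_top ENNReal.ofNat_lt_top htop

end WeightedTailSup

section Assembly

theorem normlL_le_of_forall_le {ι : Type} {q : ℝ≥0∞} {α : ℝ} {c : ι → ℂ} {K : ℝ≥0} {F : ℕ → ℝ≥0∞}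
    (h : ∀ k, (∑ i ∈ Finset.range (k + 1), seqRearr c i ^ 2) ^ (1 / 2 : ℝ) ≤ K * F k) :
    normlL q α c ≤ K * eLpNorm (fun k : ℕ => weight q α (k + 1) * F k) q Measure.count := by
  rw [normlL_eq_eLpNorm_weight]
  refine eLpNorm_le_mul_eLpNorm_of_ae_le_mul' (.of_forall fun k => ?_) q
  simp only [enorm_eq_self]
  rw [mul_left_comm]
  gcongr
  exact h k

theorem exists_normlL_fourierCoeffs_le (q : ℝ≥0∞) {α : ℝ} (hα : α ≤ 0) :
    ∃ C : ℝ≥0, ∀ (ι : Type) (φ : ι → Lp ℂ 2 μ01) (M : ℝ≥0), 1 ≤ M → IsBesselFamily ℂ φ →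
      (∀ n, eLpNorm (φ n) ∞ μ01 ≤ M) → ∀ f : ℝ → ℂ, Integrable f μ01 →
        normlL q α (fourierCoeffs φ f) ≤
          C * ENNReal.ofReal ((1 + Real.log M) ^ (-α)) * normLR q α f := by
  obtain ⟨C, hC⟩ := exists_eLpNorm_tailSup_le q hα
  refine ⟨13 * C, fun ι φ M hM1 hφ hM f hf => ?_⟩
  calc normlL q α (fourierCoeffs φ f)
      ≤ 13 * eLpNorm (fun k : ℕ => weight q α (k + 1) *
          tailSup (rearr f) (1 / M ^ 2 / (k + 1))) q Measure.count :=
        normlL_le_of_forall_le (sum_seqRearr_fourierCoeffs_rpow_half_le hM1 hφ hM hf)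
    _ ≤ 13 * (C * (ENNReal.ofReal ((1 + Real.log M) ^ (-α)) * normLR q α f)) := by
        gcongr
        exact hC (rearr f) M (by exact_mod_cast hM1)
    _ = _ := by push_cast; ring

end Assembly

end LimitingFourier

open LimitingFourier in
theorem theorem1p1_general {q : ℝ≥0∞} (hq : 0 < q) {α : ℝ} (hα : α ≤ 0) :
    ∃ C : ℝ≥0, 0 < C ∧ ∀ (ι : Type) (φ : ι → Lp ℂ 2 μ01) (M : ℝ≥0), 1 ≤ M →
      IsBesselFamily ℂ φ → (∀ n, eLpNorm (φ n) ∞ μ01 ≤ M) → ∀ f : ℝ → ℂ, MemLR q α f →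
        Integrable f μ01 ∧ normlL q α (fourierCoeffs φ f) ≤
          C * ENNReal.ofReal (min (M : ℝ) ((1 + Real.log M) ^ |α|)) * normLR q α f := by
  obtain ⟨C, hC⟩ := exists_normlL_fourierCoeffs_le q hα
  set D : ℝ≥0 := ((1 + |α|) ^ |α|).toNNReal
  have hmin (M : ℝ≥0) (hM : 1 ≤ M) : ENNReal.ofReal ((1 + Real.log M) ^ (-α)) ≤
      D * ENNReal.ofReal (min (M : ℝ) ((1 + Real.log M) ^ |α|)) := by
    rw [← ENNReal.ofReal, ← ENNReal.ofReal_mul (by positivity), ← abs_of_nonpos hα]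
    exact ENNReal.ofReal_le_ofReal (one_add_log_rpow_le_mul_min (abs_nonneg α) hM)
  refine ⟨C * D + 1, by positivity, fun ι φ M hM1 hφ hM f hf => ?_⟩
  have hint : Integrable f μ01 := hf.integrable hq hα
  refine ⟨hint, (hC ι φ M hM1 hφ hM f hint).trans ?_⟩
  gcongr ?_ * normLR q α f
  calc C * ENNReal.ofReal ((1 + Real.log M) ^ (-α))
      ≤ C * (D * ENNReal.ofReal (min (M : ℝ) ((1 + Real.log M) ^ |α|))) := by
        gcongr
        exact hmin M hM1
    _ ≤ (C * D + 1 : ℝ≥0) * ENNReal.ofReal (min (M : ℝ) ((1 + Real.log M) ^ |α|)) := by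
        rw [← mul_assoc]
        gcongr
        exact_mod_cast le_self_add

theorem theorem1p1 (q : ℝ≥0∞) (hq : 0 < q) (α : ℝ) (hα : α < -(q⁻¹).toReal) :
    ∃ C : ℝ≥0, 0 < C ∧
      ∀ (ι : Type) [Nonempty ι] (φ : ι → Lp ℂ 2 LimitingFourier.μ01) (M : ℝ≥0),
        Orthonormal ℂ φ →
        (⨆ n, eLpNorm (φ n) ∞ LimitingFourier.μ01) = (M : ℝ≥0∞) →
        ∀ f : ℝ → ℂ, LimitingFourier.MemLR q α f →
          Integrable f LimitingFourier.μ01 ∧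
          LimitingFourier.normlL q α (LimitingFourier.fourierCoeffs φ f) ≤
            (C : ℝ≥0∞) *
              ENNReal.ofReal (min (M : ℝ) ((1 + Real.log (M : ℝ)) ^ |α|)) *
              LimitingFourier.normLR q α f := by
  obtain ⟨C, hC, h⟩ := theorem1p1_general hq (hα.le.trans (neg_nonpos.2 ENNReal.toReal_nonneg))
  refine ⟨C, hC, fun ι ⟨n⟩ φ M hφ hM f hf => ?_⟩
  have hle (n : ι) : eLpNorm (φ n) ∞ LimitingFourier.μ01 ≤ M :=
    hM ▸ le_iSup (fun n => eLpNorm (φ n) ∞ LimitingFourier.μ01) n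
  exact h ι φ M (LimitingFourier.one_le_of_norm_eq_one (hφ.1 n) (hle n))
    (fun g _ => hφ.sum_inner_products_le g) hle f hf
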